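/- **Theorem (Polynomial-Time CMAPF).** An instance of the combinatorial multi-agent path finding problem (CMAPF) consists of a finite simple undirected graph on $n$ nodes with edge weights $w(u,v)=w(v,u)\in\mathbb N$ (travel times), together with $k$ agents that have pairwise distinct starting nodes and a set of $m\ge k$ goal nodes. A *route* of an agent is a finite sequence of nodes that begins at its starting node (at time $0$) and in which each step either waits at the current node, at cost $1$, or traverses an edge $\{u,v\}$, at cost $w(u,v)$; at the end of its route an agent stays at its last node for ever. A *solution* is a family of $k$ routes, one for each agent, that together visit all $m$ goals and are collision-free: no two distinct agents are ever located at the same node at the same time, and no two distinct agents traverse the same edge, in whichever directions, during overlapping periods of time. The instance is *solvable* if a solution exists; optimality of a solution is not required. There is one deterministic random access machine program (unit cost; integer variables and arrays, with addition and truncated subtraction, tests and loops), which receives $n,k,m$, the weighted adjacency matrix, the starting nodes and the goals as input, such that the following holds. For every polynomial $q$ there is a polynomial $p$ such that, on every instance whose edge weights are all at most $q(n)$, the program halts after at most $p(n,k,m)$ steps, correctly reports whether the instance is solvable, and, if it is, outputs a solution, written as a list of at most $p(n,k,m)$ (agent, node) entries, in which each agent's route is the sequence of nodes in its entries, in order.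 -/

import Mathlib

/-! ## Random access machine programs with a step count -/

namespace RAM

/-- Memory of the machine: scalar variables and one-dimensional arrays of natural numbers. -/
structure State where
  var : ℕ → ℕ
  arr : ℕ → ℕ → ℕ

/-- Expressions. Multiplication is deliberately absent: with addition and truncated subtraction
only, the number of steps (unit cost) is polynomially related to Turing machine time. -/
inductive Expr where
  | lit (c : ℕ)
  | var (x : ℕ)
  | get (a : ℕ) (i : Expr)
  | add (e f : Expr)
  | sub (e f : Expr)

/-- Value of an expression; `get a i` reads entry `i` of array `a`. -/
def Expr.eval (σ : State) : Expr → ℕ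
  | .lit c => c
  | .var x => σ.var x
  | .get a i => σ.arr a (i.eval σ)
  | .add e f => e.eval σ + f.eval σ
  | .sub e f => e.eval σ - f.eval σ

/-- Number of elementary operations needed to evaluate an expression. -/
def Expr.cost : Expr → ℕ
  | .lit _ => 1
  | .var _ => 1
  | .get _ i => i.cost + 1
  | .add e f => e.cost + f.cost + 1
  | .sub e f => e.cost + f.cost + 1

/-- Programs. -/
inductive Cmd where
  | skip
  | assign (x : ℕ) (e : Expr)
  | store (a : ℕ) (i e : Expr)
  | seq (c d : Cmd)
  | ite (e : Expr) (c d : Cmd)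
  | while (e : Expr) (c : Cmd)

def State.setVar (σ : State) (x v : ℕ) : State :=
  { σ with var := Function.update σ.var x v }

def State.setArr (σ : State) (a i v : ℕ) : State :=
  { σ with arr := Function.update σ.arr a (Function.update (σ.arr a) i v) }

/-- `Exec c σ t τ`: the program `c`, started in `σ`, halts in `τ` after exactly `t` steps.
A condition counts as true when its value is nonzero. -/
inductive Exec : Cmd → State → ℕ → State → Prop where
  | skip (σ : State) : Exec .skip σ 1 σ
  | assign (σ : State) (x : ℕ) (e : Expr) :
      Exec (.assign x e) σ (e.cost + 1) (σ.setVar x (e.eval σ))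
  | store (σ : State) (a : ℕ) (i e : Expr) :
      Exec (.store a i e) σ (i.cost + e.cost + 1) (σ.setArr a (i.eval σ) (e.eval σ))
  | seq {c d : Cmd} {σ τ ρ : State} {s t : ℕ} :
      Exec c σ s τ → Exec d τ t ρ → Exec (.seq c d) σ (s + t) ρ
  | ite_true {e : Expr} {c d : Cmd} {σ τ : State} {t : ℕ} :
      e.eval σ ≠ 0 → Exec c σ t τ → Exec (.ite e c d) σ (e.cost + 1 + t) τ
  | ite_false {e : Expr} {c d : Cmd} {σ τ : State} {t : ℕ} :
      e.eval σ = 0 → Exec d σ t τ → Exec (.ite e c d) σ (e.cost + 1 + t) τ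
  | while_true {e : Expr} {c : Cmd} {σ τ ρ : State} {s t : ℕ} :
      e.eval σ ≠ 0 → Exec c σ s τ → Exec (.while e c) τ t ρ →
        Exec (.while e c) σ (e.cost + 1 + s + t) ρ
  | while_false {e : Expr} {c : Cmd} {σ : State} :
      e.eval σ = 0 → Exec (.while e c) σ (e.cost + 1) σ

end RAM

/-! ## Combinatorial multi-agent path finding -/

/-- An instance: an undirected graph with natural edge weights (travel times; only the values on
edges matter), `k` agents with distinct starting nodes, and `m` distinct goal nodes. -/
structure CMAPF where
  n : ℕ
  k : ℕ
  m : ℕ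
  G : SimpleGraph (Fin n)
  w : Sym2 (Fin n) → ℕ
  start : Fin k → Fin n
  start_injective : Function.Injective start
  goal : Fin m → Fin n
  goal_injective : Function.Injective goal

namespace CMAPF

variable (I : CMAPF)

/-- An agent may traverse an edge, or wait at its node (self-loop). -/
def Step (u v : Fin I.n) : Prop := u = v ∨ I.G.Adj u v

/-- Travel time of a step; waiting takes one unit. -/
def cost (u v : Fin I.n) : ℕ := if u = v then 1 else I.w s(u, v)

/-- The pairs (time, node) at which an agent that follows the given route from time `t` on
reaches the successive nodes of the route. -/
def visits : ℕ → List (Fin I.n) → List (ℕ × Fin I.n)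
  | _, [] => []
  | t, [u] => [(t, u)]
  | t, u :: v :: l => (t, u) :: visits (t + I.cost u v) (v :: l)

/-- The steps (departure time, from, to) of an agent that follows the given route from time `t`. -/
def moves : ℕ → List (Fin I.n) → List (ℕ × Fin I.n × Fin I.n)
  | _, [] => []
  | _, [_] => []
  | t, u :: v :: l => (t, u, v) :: moves (t + I.cost u v) (v :: l)

/-- An agent with route `r` is located at node `v` at time `t`. After the end of its route an agent
stays at the last node for ever. -/
def LocatedAt (r : List (Fin I.n)) (t : ℕ) (v : Fin I.n) : Prop :=
  (t, v) ∈ I.visits 0 r ∨ ∃ t₀ ≤ t, (I.visits 0 r).getLast? = some (t₀, v)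

/-- Two agents are located at the same node at the same time. -/
def NodeConflict (r r' : List (Fin I.n)) : Prop :=
  ∃ t v, I.LocatedAt r t v ∧ I.LocatedAt r' t v

/-- Two agents traverse the same edge (in either direction) during overlapping periods of time. -/
def EdgeConflict (r r' : List (Fin I.n)) : Prop :=
  ∃ t u v t' u' v', (t, u, v) ∈ I.moves 0 r ∧ (t', u', v') ∈ I.moves 0 r' ∧
    u ≠ v ∧ s(u, v) = s(u', v') ∧ t < t' + I.cost u' v' ∧ t' < t + I.cost u v

/-- Collision-free routes, one for each agent, that together visit all goals. -/
structure IsSolution (π : Fin I.k → List (Fin I.n)) : Prop where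
  starts : ∀ i, (π i).head? = some (I.start i)
  steps : ∀ i, (π i).IsChain I.Step
  visits_goals : ∀ j, ∃ i, I.goal j ∈ π i
  no_node_conflict : ∀ i i', i ≠ i' → ¬ I.NodeConflict (π i) (π i')
  no_edge_conflict : ∀ i i', i ≠ i' → ¬ I.EdgeConflict (π i) (π i')

def Solvable : Prop := ∃ π, I.IsSolution π

open Classical in
/-- Adjacency matrix entry: `0` for no edge, `w + 1` for an edge of weight `w`. -/
noncomputable def entry (u v : Fin I.n) : ℕ := if I.G.Adj u v then I.w s(u, v) + 1 else 0

/-- Initial memory. Variables 0, 1, 2 hold `n`, `k`, `m`; array 0 holds the adjacency matrix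
row by row (the entry for `(u, v)` at position `u * n + v`), array 1 the starting nodes and
array 2 the goals; everything else is `0`. -/
noncomputable def input : RAM.State where
  var x := if x = 0 then I.n else if x = 1 then I.k else if x = 2 then I.m else 0
  arr a p :=
    if a = 0 then
      if h : p < I.n * I.n then
        I.entry (finProdFinEquiv.symm ⟨p, h⟩).1 (finProdFinEquiv.symm ⟨p, h⟩).2
      else 0
    else if a = 1 then if h : p < I.k then I.start ⟨p, h⟩ else 0
    else if a = 2 then if h : p < I.m then I.goal ⟨p, h⟩ else 0
    else 0

/-- The routes written in the final memory: a list of entries (agent, node), of length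
variable 4, with the agents in array 3 and the nodes in array 4. The route of agent `i`
consists of the nodes of the entries with agent `i`, in order. -/
def outputRoute (σ : RAM.State) (i : ℕ) : List ℕ :=
  ((List.range (σ.var 4)).filter (fun j => σ.arr 3 j = i)).map (σ.arr 4)

/-- The final memory is a correct answer: variable 3 tells whether the instance is solvable, and
if it is, the routes written in memory are a solution. -/
def CorrectAnswer (σ : RAM.State) : Prop :=
  (I.Solvable → σ.var 3 = 1 ∧
    ∃ π, I.IsSolution π ∧ ∀ i : Fin I.k, outputRoute σ i = (π i).map Fin.val) ∧
  (¬ I.Solvable → σ.var 3 = 0)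

end CMAPF

/-! ### Node-disjoint routes and closed sets of nodes. -/

namespace CMAPF

variable (I : CMAPF)

/-! Collisions are avoided by space rather than by timing. Agents whose routes have no node in
common can never meet at a node or on an edge, whatever the travel times
(`not_nodeConflict_of_disjoint`, `not_edgeConflict_of_disjoint`). So it suffices to divide the nodes
reachable from the starting nodes into disjoint regions, one per agent, each explored by its own
agent.

A depth-first search does this. All starting nodes are marked in advance, so no agent enters
another's start. The agents set out in turn; each moves to unmarked neighbours, marking them, and
otherwise walks back along its stack. `Tour` is the invariant. When all agents are done, the marked
set contains the starts and is closed under adjacency, so no solution can leave it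
(`IsSolution.mem_of_closed`). Hence the instance is solvable exactly when all goals are marked, and
then the recorded routes are a solution (`Tour.solvable_iff`, `Tour.isSolution`).

For the running time, count 2 for each unmarked node and 1 for each stack entry. Every move lowers
this count by one and writes at most one output entry (`runs_advance`). This bounds the number of
moves, and the output length by `2n + 2k`. The rest is a program logic with step bounds (`Runs`),
and a proof that the memory represents the search state (`Rep`). -/

theorem snd_mem_of_mem_visits (l : List (Fin I.n)) (t : ℕ) (p : ℕ × Fin I.n)
    (h : p ∈ I.visits t l) : p.2 ∈ l := by
  induction l generalizing t with
  | nil => simp [visits] at h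
  | cons u l ih =>
    cases l with
    | nil => simp [visits] at h; simp [h]
    | cons v l =>
      simp only [visits, List.mem_cons] at h
      rcases h with h | h
      · simp [h]
      · exact List.mem_cons_of_mem _ (ih _ h)

theorem mem_of_mem_moves (l : List (Fin I.n)) (t : ℕ) (p : ℕ × Fin I.n × Fin I.n)
    (h : p ∈ I.moves t l) : p.2.1 ∈ l ∧ p.2.2 ∈ l := by
  induction l generalizing t with
  | nil => simp [moves] at h
  | cons u l ih =>
    cases l with
    | nil => simp [moves] at h
    | cons v l =>
      simp only [moves, List.mem_cons] at h
      rcases h with h | h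
      · simp [h]
      · exact ⟨List.mem_cons_of_mem _ (ih _ h).1, List.mem_cons_of_mem _ (ih _ h).2⟩

theorem LocatedAt.mem {I : CMAPF} {r : List (Fin I.n)} {t : ℕ} {v : Fin I.n}
    (h : I.LocatedAt r t v) : v ∈ r := by
  rcases h with h | ⟨t₀, -, h⟩
  · exact I.snd_mem_of_mem_visits r 0 _ h
  · exact I.snd_mem_of_mem_visits r 0 _ (List.mem_of_getLast? h)

theorem not_nodeConflict_of_disjoint {r r' : List (Fin I.n)} (h : r.Disjoint r') :
    ¬ I.NodeConflict r r' :=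
  fun ⟨_, _, h₁, h₂⟩ => h h₁.mem h₂.mem

theorem not_edgeConflict_of_disjoint {r r' : List (Fin I.n)} (h : r.Disjoint r') :
    ¬ I.EdgeConflict r r' := by
  rintro ⟨t, u, v, t', u', v', h₁, h₂, -, he, -⟩
  have h₁ := I.mem_of_mem_moves r 0 _ h₁
  have h₂ := I.mem_of_mem_moves r' 0 _ h₂
  rcases Sym2.eq_iff.1 he with ⟨rfl, -⟩ | ⟨rfl, -⟩
  · exact h h₁.1 h₂.1
  · exact h h₁.1 h₂.2

/-- Routes from the starting nodes stay within a set of nodes that contains the starting nodes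
and is closed under adjacency. -/
theorem IsSolution.mem_of_closed {I : CMAPF} {π : Fin I.k → List (Fin I.n)} (h : I.IsSolution π)
    {V : Finset (Fin I.n)} (hs : ∀ i, I.start i ∈ V)
    (hV : ∀ v ∈ V, ∀ w, I.G.Adj v w → w ∈ V) (i : Fin I.k) {v : Fin I.n} (hv : v ∈ π i) :
    v ∈ V := by
  have key : ∀ (l : List (Fin I.n)) (s : Fin I.n), l.head? = some s → s ∈ V →
      l.IsChain I.Step → ∀ v ∈ l, v ∈ V := by
    intro l
    induction l with
    | nil => simp
    | cons a l ih =>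
      intro s hs hsV hc v hv
      obtain rfl : a = s := by simpa using hs
      rcases List.mem_cons.1 hv with rfl | hv
      · exact hsV
      cases l with
      | nil => simp at hv
      | cons b l =>
        rw [List.isChain_cons_cons] at hc
        refine ih b rfl ?_ hc.2 v hv
        rcases hc.1 with rfl | hab
        · exact hsV
        · exact hV _ hsV _ hab
  exact key _ _ (h.starts i) (hs i) (h.steps i) v hv

/-! ### The abstract depth-first search and its invariant. -/

/-- State of a search in which the agents explore the graph one after another, depth first:
`c` agents have set out, `V` is the set of marked nodes (all starting nodes are marked at the
outset), `S` is the stack of the last agent to have set out, and `R` holds the routes so far. -/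
structure Tour (c : ℕ) (V : Finset (Fin I.n)) (S : List (Fin I.n))
    (R : Fin I.k → List (Fin I.n)) : Prop where
  start_mem : ∀ i, I.start i ∈ V
  route_nil : ∀ i : Fin I.k, c ≤ i → R i = []
  head : ∀ i : Fin I.k, i < c → (R i).head? = some (I.start i)
  chain : ∀ i, (R i).IsChain I.Step
  subset : ∀ i, ∀ v ∈ R i, v ∈ V
  disjoint : ∀ i j, i ≠ j → (R i).Disjoint (R j)
  eq_of_start_mem : ∀ i j, I.start j ∈ R i → i = j
  cover : ∀ v ∈ V, (∃ i, v ∈ R i) ∨ ∃ i : Fin I.k, c ≤ i ∧ v = I.start i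
  stack_chain : S.IsChain I.G.Adj
  stack_last : ∀ x ∈ S.head?, ∀ i : Fin I.k, i.val + 1 = c → x ∈ (R i).getLast?
  stack_subset : ∀ i : Fin I.k, i.val + 1 = c → ∀ x ∈ S, x ∈ R i
  closed : ∀ v ∈ V, v ∈ S ∨ (∃ i : Fin I.k, c ≤ i ∧ v = I.start i) ∨
    ∀ w, I.G.Adj v w → w ∈ V

variable {I}

theorem Tour.init : I.Tour 0 (Finset.univ.image I.start) [] (fun _ => []) where
  start_mem i := by simp
  route_nil _ _ := rfl
  head i h := by simp at h
  chain _ := by simp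
  subset := by simp
  disjoint := by simp
  eq_of_start_mem := by simp
  cover v hv := by
    obtain ⟨i, -, rfl⟩ := Finset.mem_image.1 hv
    exact .inr ⟨i, Nat.zero_le _, rfl⟩
  stack_chain := by simp
  stack_last := by simp
  stack_subset := by simp
  closed v hv := by
    obtain ⟨i, -, rfl⟩ := Finset.mem_image.1 hv
    exact .inr (.inl ⟨i, Nat.zero_le _, rfl⟩)

/-- The routes after agent `a` has moved on to the node `x`. -/
def extend (R : Fin I.k → List (Fin I.n)) (a : Fin I.k) (x : Fin I.n) :
    Fin I.k → List (Fin I.n) :=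
  fun i => if i = a then R i ++ [x] else R i

theorem mem_extend {R : Fin I.k → List (Fin I.n)} {a i : Fin I.k} {x v : Fin I.n} :
    v ∈ extend R a x i ↔ v ∈ R i ∨ i = a ∧ v = x := by
  unfold extend; split_ifs with h <;> simp [h]

theorem disjoint_extend {R : Fin I.k → List (Fin I.n)} {a : Fin I.k} {x : Fin I.n}
    (hR : ∀ i j, i ≠ j → (R i).Disjoint (R j)) (hx : ∀ i ≠ a, x ∉ R i) (i j : Fin I.k)
    (hij : i ≠ j) : (extend R a x i).Disjoint (extend R a x j) := by
  intro v hi hj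
  rw [mem_extend] at hi hj
  rcases hi with hi | ⟨rfl, rfl⟩ <;> rcases hj with hj | ⟨rfl, h⟩
  · exact hR i j hij hi hj
  · exact hx i hij (h ▸ hi)
  · exact hx j hij.symm hj
  · exact hij rfl

theorem chain_extend {R : Fin I.k → List (Fin I.n)} {a : Fin I.k} {x : Fin I.n}
    (hR : ∀ i, (R i).IsChain I.Step) (hx : ∀ y ∈ (R a).getLast?, I.Step y x) (i : Fin I.k) :
    (extend R a x i).IsChain I.Step := by
  unfold extend
  split_ifs with h
  · subst h
    exact List.isChain_append.2 ⟨hR i, by simp, by simpa using hx⟩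
  · exact hR i

theorem head_extend {R : Fin I.k → List (Fin I.n)} {a i : Fin I.k} {x y : Fin I.n}
    (h : (R i).head? = some y) : (extend R a x i).head? = some y := by
  unfold extend
  split_ifs <;> simp [h]

/-- By `eq_of_start_mem` the start of `a` lies on no other route, so routes stay disjoint. It passes
from the waiting starts to the stack, which keeps `cover` and `closed` true. -/
theorem Tour.setOut {c : ℕ} {V : Finset (Fin I.n)} {R : Fin I.k → List (Fin I.n)}
    (h : I.Tour c V [] R) (a : Fin I.k) (ha : a.val = c) :
    I.Tour (c + 1) V [I.start a] (extend R a (I.start a)) := by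
  have hnil : R a = [] := h.route_nil a ha.ge
  refine ⟨h.start_mem, fun i hi => ?_, fun i hi => ?_, chain_extend h.chain (by simp [hnil]),
    fun i v hv => ?_, disjoint_extend h.disjoint fun i hi hm => hi (h.eq_of_start_mem i a hm),
    fun i j hm => ?_, fun v hv => ?_, by simp, fun x hx i hi => ?_, fun i hi x hx => ?_,
    fun v hv => ?_⟩
  · have : i ≠ a := by rintro rfl; omega
    simp [extend, this, h.route_nil i (by omega)]
  · rcases eq_or_ne i a with rfl | hia
    · simp [extend, hnil]
    · have : i.val ≠ a.val := fun e => hia (Fin.ext e)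
      exact head_extend (h.head i (by omega))
  · rcases mem_extend.1 hv with hv | ⟨-, rfl⟩
    · exact h.subset i v hv
    · exact h.start_mem a
  · rcases mem_extend.1 hm with hm | ⟨rfl, e⟩
    · exact h.eq_of_start_mem i j hm
    · exact (I.start_injective e).symm
  · rcases h.cover v hv with ⟨i, hi⟩ | ⟨i, hi, rfl⟩
    · exact .inl ⟨i, mem_extend.2 (.inl hi)⟩
    · rcases eq_or_ne i a with rfl | hia
      · exact .inl ⟨i, mem_extend.2 (.inr ⟨rfl, rfl⟩)⟩
      · have : i.val ≠ a.val := fun e => hia (Fin.ext e)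
        exact .inr ⟨i, by omega, rfl⟩
  · obtain rfl : i = a := Fin.ext (by omega)
    simpa [extend] using hx
  · obtain rfl : i = a := Fin.ext (by omega)
    exact mem_extend.2 (.inr ⟨rfl, by simpa using hx⟩)
  · rcases h.closed v hv with hS | ⟨i, hi, rfl⟩ | hw
    · simp at hS
    · rcases eq_or_ne i a with rfl | hia
      · exact .inl (by simp)
      · have : i.val ≠ a.val := fun e => hia (Fin.ext e)
        exact .inr (.inl ⟨i, by omega, rfl⟩)
    · exact .inr (.inr hw)

/-- An unmarked node lies on no route and is no agent's start, so entering it breaks neither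
disjointness nor `eq_of_start_mem`. -/
theorem Tour.push {c : ℕ} {V : Finset (Fin I.n)} {S : List (Fin I.n)}
    {R : Fin I.k → List (Fin I.n)} {x y : Fin I.n} (h : I.Tour c V (x :: S) R) (a : Fin I.k)
    (ha : a.val + 1 = c) (hxy : I.G.Adj x y) (hy : y ∉ V) :
    I.Tour c (insert y V) (y :: x :: S) (extend R a y) := by
  have hyR : ∀ i, y ∉ R i := fun i hi => hy (h.subset i y hi)
  have hlast : x ∈ (R a).getLast? := h.stack_last x (by simp) a ha
  refine ⟨fun i => Finset.mem_insert_of_mem (h.start_mem i), fun i hi => ?_,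
    fun i hi => head_extend (h.head i hi), chain_extend h.chain fun z hz => ?_, fun i v hv => ?_,
    disjoint_extend h.disjoint fun i _ => hyR i, fun i j hm => ?_, fun v hv => ?_,
    ?_, fun z hz i hi => ?_, fun i hi z hz => ?_, fun v hv => ?_⟩
  · have : i ≠ a := by rintro rfl; omega
    simp [extend, this, h.route_nil i hi]
  · obtain rfl : x = z := Option.mem_unique hlast hz
    exact .inr hxy
  · rcases mem_extend.1 hv with hv | ⟨-, rfl⟩
    · exact Finset.mem_insert_of_mem (h.subset i v hv)
    · exact Finset.mem_insert_self _ _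
  · rcases mem_extend.1 hm with hm | ⟨rfl, e⟩
    · exact h.eq_of_start_mem i j hm
    · exact absurd (e ▸ h.start_mem j) hy
  · rcases Finset.mem_insert.1 hv with rfl | hv
    · exact .inl ⟨a, mem_extend.2 (.inr ⟨rfl, rfl⟩)⟩
    · exact (h.cover v hv).imp_left fun ⟨i, hi⟩ => ⟨i, mem_extend.2 (.inl hi)⟩
  · exact List.isChain_cons_cons.2 ⟨hxy.symm, h.stack_chain⟩
  · obtain rfl : i = a := Fin.ext (by omega)
    simpa [extend] using hz
  · obtain rfl : i = a := Fin.ext (by omega)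
    rcases List.mem_cons.1 hz with rfl | hz
    · exact mem_extend.2 (.inr ⟨rfl, rfl⟩)
    · exact mem_extend.2 (.inl (h.stack_subset i hi z hz))
  · rcases Finset.mem_insert.1 hv with rfl | hv
    · exact .inl (by simp)
    · exact (h.closed v hv).imp (List.mem_cons_of_mem _)
        (Or.imp_right fun hw w hvw => Finset.mem_insert_of_mem (hw w hvw))

/-- There is no node to go back to: the route simply ends, and no entry is added. -/
theorem Tour.pop_last {c : ℕ} {V : Finset (Fin I.n)}
    {R : Fin I.k → List (Fin I.n)} {x : Fin I.n} (h : I.Tour c V [x] R)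
    (hx : ∀ w, I.G.Adj x w → w ∈ V) : I.Tour c V [] R where
  __ := h
  stack_chain := by simp
  stack_last := by simp
  stack_subset := by simp
  closed v hv := by
    rcases h.closed v hv with hS | hw
    · obtain rfl : v = x := by simpa using hS
      exact .inr (.inr hx)
    · exact .inr hw

/-- The agent walks back along the edge by which it entered `x`. The node `z` is already on its
route, so the route grows but its set of nodes does not. -/
theorem Tour.pop {c : ℕ} {V : Finset (Fin I.n)} {S : List (Fin I.n)}
    {R : Fin I.k → List (Fin I.n)} {x z : Fin I.n} (h : I.Tour c V (x :: z :: S) R) (a : Fin I.k)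
    (ha : a.val + 1 = c) (hx : ∀ w, I.G.Adj x w → w ∈ V) :
    I.Tour c V (z :: S) (extend R a z) := by
  have hlast : x ∈ (R a).getLast? := h.stack_last x (by simp) a ha
  have hza : z ∈ R a := h.stack_subset a ha z (by simp)
  have hchain := List.isChain_cons_cons.1 h.stack_chain
  have hmem : ∀ {i v}, v ∈ extend R a z i ↔ v ∈ R i := fun {i v} => by
    rw [mem_extend, or_iff_left_iff_imp]
    rintro ⟨rfl, rfl⟩
    exact hza
  refine ⟨h.start_mem, fun i hi => ?_,
    fun i hi => head_extend (h.head i hi), chain_extend h.chain fun y hy => ?_,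
    fun i v hv => h.subset i v (hmem.1 hv),
    fun i j hij v hi hj => h.disjoint i j hij (hmem.1 hi) (hmem.1 hj),
    fun i j hm => h.eq_of_start_mem i j (hmem.1 hm), fun v hv => ?_,
    hchain.2, fun y hy i hi => ?_, fun i hi y hy => ?_, fun v hv => ?_⟩
  · have : i ≠ a := by rintro rfl; omega
    simp [extend, this, h.route_nil i hi]
  · obtain rfl : x = y := Option.mem_unique hlast hy
    exact .inr hchain.1
  · exact (h.cover v hv).imp_left fun ⟨i, hi⟩ => ⟨i, hmem.2 hi⟩
  · obtain rfl : i = a := Fin.ext (by omega)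
    simpa [extend] using hy
  · exact hmem.2 (h.stack_subset i hi y (List.mem_cons_of_mem _ hy))
  · rcases h.closed v hv with hS | hw
    · rcases List.mem_cons.1 hS with rfl | hS
      · exact .inr (.inr hx)
      · exact .inl hS
    · exact .inr hw

/-- With an empty stack and no agent waiting, only the third alternative of `closed` is left. -/
theorem Tour.closed_of_finished {V : Finset (Fin I.n)} {R : Fin I.k → List (Fin I.n)}
    (h : I.Tour I.k V [] R) : ∀ v ∈ V, ∀ w, I.G.Adj v w → w ∈ V := by
  intro v hv
  rcases h.closed v hv with hS | ⟨i, hi, -⟩ | hw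
  · simp at hS
  · exact absurd i.isLt (not_lt.2 hi)
  · exact hw

theorem Tour.isSolution {V : Finset (Fin I.n)} {R : Fin I.k → List (Fin I.n)}
    (h : I.Tour I.k V [] R) (hg : ∀ j, I.goal j ∈ V) : I.IsSolution R where
  starts i := h.head i i.isLt
  steps := h.chain
  visits_goals j := by
    rcases h.cover _ (hg j) with hi | ⟨i, hi, -⟩
    · exact hi
    · exact absurd i.isLt (not_lt.2 hi)
  no_node_conflict i j hij := I.not_nodeConflict_of_disjoint (h.disjoint i j hij)
  no_edge_conflict i j hij := I.not_edgeConflict_of_disjoint (h.disjoint i j hij)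

theorem Tour.solvable_iff {V : Finset (Fin I.n)} {R : Fin I.k → List (Fin I.n)}
    (h : I.Tour I.k V [] R) : I.Solvable ↔ ∀ j, I.goal j ∈ V := by
  refine ⟨fun ⟨π, hπ⟩ j => ?_, fun hg => ⟨R, h.isSolution hg⟩⟩
  obtain ⟨i, hi⟩ := hπ.visits_goals j
  exact hπ.mem_of_closed h.start_mem h.closed_of_finished i hi

end CMAPF

/-! ### A program logic with step bounds. -/

namespace RAM

/-- The program `c`, started in `σ`, halts within `T` steps in a state that satisfies `Q`. -/
def Runs (c : Cmd) (σ : State) (T : ℕ) (Q : State → Prop) : Prop :=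
  ∃ t τ, Exec c σ t τ ∧ t ≤ T ∧ Q τ

theorem Runs.mono {c : Cmd} {σ : State} {T T' : ℕ} {Q Q' : State → Prop} (h : Runs c σ T Q)
    (hT : T ≤ T') (hQ : ∀ τ, Q τ → Q' τ) : Runs c σ T' Q' :=
  let ⟨t, τ, he, ht, hq⟩ := h
  ⟨t, τ, he, ht.trans hT, hQ τ hq⟩

theorem Runs.skip {σ : State} {Q : State → Prop} (h : Q σ) : Runs .skip σ 1 Q :=
  ⟨1, σ, .skip σ, le_rfl, h⟩

theorem Runs.assign {σ : State} {x : ℕ} {e : Expr} {Q : State → Prop}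
    (h : Q (σ.setVar x (e.eval σ))) : Runs (.assign x e) σ (e.cost + 1) Q :=
  ⟨_, _, .assign σ x e, le_rfl, h⟩

theorem Runs.store {σ : State} {a : ℕ} {i e : Expr} {Q : State → Prop}
    (h : Q (σ.setArr a (i.eval σ) (e.eval σ))) :
    Runs (.store a i e) σ (i.cost + e.cost + 1) Q :=
  ⟨_, _, .store σ a i e, le_rfl, h⟩

theorem Runs.seq {c d : Cmd} {σ : State} {s t : ℕ} {Q : State → Prop}
    (h : Runs c σ s fun τ => Runs d τ t Q) : Runs (.seq c d) σ (s + t) Q :=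
  let ⟨_, _, hc, hs, _, ρ, hd, ht, hq⟩ := h
  ⟨_, ρ, .seq hc hd, add_le_add hs ht, hq⟩

theorem Runs.ite {e : Expr} {c d : Cmd} {σ : State} {s t : ℕ} {Q : State → Prop}
    (hc : e.eval σ ≠ 0 → Runs c σ s Q) (hd : e.eval σ = 0 → Runs d σ t Q) :
    Runs (.ite e c d) σ (e.cost + 1 + max s t) Q := by
  by_cases he : e.eval σ = 0
  · obtain ⟨u, τ, h, hu, hq⟩ := hd he
    exact ⟨_, τ, .ite_false he h, by omega, hq⟩
  · obtain ⟨u, τ, h, hu, hq⟩ := hc he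
    exact ⟨_, τ, .ite_true he h, by omega, hq⟩

/-- `N` is a variant that may drop by any positive amount; the `+ 1` charges the final failing test
as a full round. -/
theorem Runs.while {e : Expr} {c : Cmd} {B : ℕ} {Q : State → Prop} (Inv : ℕ → State → Prop)
    (hbody : ∀ N σ, Inv N σ → e.eval σ ≠ 0 → ∃ M < N, Runs c σ B (Inv M))
    (hexit : ∀ N σ, Inv N σ → e.eval σ = 0 → Q σ) {N : ℕ} {σ : State} (h : Inv N σ) :
    Runs (.while e c) σ ((N + 1) * (e.cost + 1 + B)) Q := by
  induction N using Nat.strong_induction_on generalizing σ with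
  | _ N ih =>
    by_cases he : e.eval σ = 0
    · exact ⟨_, σ, .while_false he, by nlinarith, hexit N σ h he⟩
    · obtain ⟨M, hM, s, τ, hs, hsB, hτ⟩ := hbody N σ h he
      obtain ⟨t, ρ, ht, htB, hq⟩ := ih M hM hτ
      refine ⟨_, ρ, .while_true he hs ht, ?_, hq⟩
      have : (M + 1) * (e.cost + 1 + B) ≤ N * (e.cost + 1 + B) := Nat.mul_le_mul_right _ hM
      rw [add_mul]
      omega

/-- Execute `c` with variable `x` running from `0` up to, but excluding, variable `y`. -/
def Cmd.for (x y : ℕ) (c : Cmd) : Cmd :=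
  .seq (.assign x (.lit 0))
    (.while (.sub (.var y) (.var x)) (.seq c (.assign x (.add (.var x) (.lit 1)))))

/-- The counter is incremented after the body, so the body must preserve it and establish the next
invariant for the memory with the counter already advanced. The 8 is 4 for the test plus 4 for the
increment. -/
theorem Runs.for {x y : ℕ} {c : Cmd} {B N : ℕ} {Q : State → Prop} (Inv : ℕ → State → Prop)
    (hvar : ∀ j σ, Inv j σ → σ.var x = j ∧ σ.var y = N)
    (hbody : ∀ j σ, j < N → Inv j σ →
      Runs c σ B fun τ => τ.var x = j ∧ Inv (j + 1) (τ.setVar x (j + 1)))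
    (hexit : ∀ σ, Inv N σ → Q σ) {σ : State} (h : Inv 0 (σ.setVar x 0)) :
    Runs (.for x y c) σ (2 + (N + 1) * (8 + B)) Q := by
  refine .seq (.assign ?_)
  refine (Runs.while (B := B + 4) (fun M σ => ∃ j ≤ N, M = N - j ∧ Inv j σ) ?_ ?_
    ⟨0, Nat.zero_le _, rfl, h⟩).mono ?_ fun _ => id
  · rintro _ σ ⟨j, hj, rfl, hI⟩ he
    simp only [Expr.eval, hvar j σ hI] at he
    refine ⟨N - (j + 1), by omega, .seq ((hbody j σ (by omega) hI).mono le_rfl ?_)⟩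
    rintro τ ⟨hτ, hI'⟩
    exact .assign ⟨j + 1, by omega, rfl, by simpa [Expr.eval, hτ] using hI'⟩
  · rintro _ σ ⟨j, hj, rfl, hI⟩ he
    simp only [Expr.eval, hvar j σ hI] at he
    obtain rfl : j = N := by omega
    exact hexit σ hI
  · simp only [Expr.cost, Nat.sub_zero]
    exact Nat.mul_le_mul_left _ (by omega)

@[simp] theorem State.var_setVar (σ : State) (x v y : ℕ) :
    (σ.setVar x v).var y = if y = x then v else σ.var y := by
  simp [State.setVar, Function.update_apply]

@[simp] theorem State.arr_setVar (σ : State) (x v : ℕ) : (σ.setVar x v).arr = σ.arr := rfl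

@[simp] theorem State.var_setArr (σ : State) (a i v : ℕ) : (σ.setArr a i v).var = σ.var := rfl

@[simp] theorem State.arr_setArr (σ : State) (a i v b : ℕ) :
    (σ.setArr a i v).arr b = if b = a then Function.update (σ.arr a) i v else σ.arr b := by
  unfold State.setArr
  by_cases h : b = a
  · subst h; simp
  · simp [h]

end RAM

/-! ### Representation of the search in memory, and output of routes. -/

namespace CMAPF

open RAM

variable {I : CMAPF}

/-- The array `st` holds the stack `S` of the given height, with its bottom at position `1`. -/
def StackRep (st : ℕ → ℕ) : ℕ → List (Fin I.n) → Prop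
  | 0, [] => True
  | d + 1, x :: S => st (d + 1) = x ∧ StackRep st d S
  | _, _ => False

theorem StackRep.length_eq {st : ℕ → ℕ} {d : ℕ} {S : List (Fin I.n)} (h : StackRep st d S) :
    d = S.length := by
  induction S generalizing d with
  | nil => cases d <;> simp_all [StackRep]
  | cons x S ih =>
    cases d with
    | zero => simp [StackRep] at h
    | succ d => simp [ih h.2]

theorem StackRep.update {st : ℕ → ℕ} {d : ℕ} {S : List (Fin I.n)} (h : StackRep st d S)
    {e : ℕ} (he : d < e) (x : ℕ) : StackRep (Function.update st e x) d S := by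
  induction S generalizing d with
  | nil => cases d <;> simp_all [StackRep]
  | cons y S ih =>
    cases d with
    | zero => simp [StackRep] at h
    | succ d =>
      refine ⟨?_, ih h.2 (by omega)⟩
      rw [Function.update_of_ne (by omega)]
      exact h.1

theorem StackRep.push {st : ℕ → ℕ} {d : ℕ} {S : List (Fin I.n)} (h : StackRep st d S)
    (x : Fin I.n) : StackRep (Function.update st (d + 1) x) (d + 1) (x :: S) :=
  ⟨by simp, h.update (Nat.lt_succ_self d) _⟩

variable (I)

/-- The memory holds the instance, with the adjacency matrix accessible through the array `7` of
row offsets. -/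
structure Holds (σ : State) : Prop where
  n : σ.var 0 = I.n
  k : σ.var 1 = I.k
  m : σ.var 2 = I.m
  entry : ∀ u v : Fin I.n, σ.arr 0 (σ.arr 7 u + v) = I.entry u v
  start : ∀ i : Fin I.k, σ.arr 1 i = I.start i
  goal : ∀ j : Fin I.m, σ.arr 2 j = I.goal j

/-- The memory holds the instance and the state of a search: marks in array `5`, the stack in
array `6`, its height in variable `6`, and the routes in the output arrays. -/
structure Rep (V : Finset (Fin I.n)) (S : List (Fin I.n)) (R : Fin I.k → List (Fin I.n))
    (σ : State) : Prop extends Holds I σ where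
  mark : ∀ v : Fin I.n, σ.arr 5 v = 0 ↔ v ∉ V
  stack : StackRep (σ.arr 6) (σ.var 6) S
  out : ∀ i : Fin I.k, outputRoute σ i = (R i).map Fin.val

variable {I}

theorem entry_eq_zero {u v : Fin I.n} : I.entry u v = 0 ↔ ¬ I.G.Adj u v := by
  unfold entry; split_ifs with h <;> simp [h]

theorem Holds.congr {σ τ : State} (h : Holds I σ) (hv : ∀ x < 3, τ.var x = σ.var x)
    (ha : ∀ a ∈ [0, 1, 2, 7], τ.arr a = σ.arr a) : Holds I τ where
  n := (hv 0 (by simp)).trans h.n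
  k := (hv 1 (by simp)).trans h.k
  m := (hv 2 (by simp)).trans h.m
  entry := by rw [ha 0 (by simp), ha 7 (by simp)]; exact h.entry
  start := by rw [ha 1 (by simp)]; exact h.start
  goal := by rw [ha 2 (by simp)]; exact h.goal

theorem outputRoute_congr {σ τ : State} (h₄ : τ.var 4 = σ.var 4) (ha₃ : τ.arr 3 = σ.arr 3)
    (ha₄ : τ.arr 4 = σ.arr 4) (i : ℕ) : outputRoute τ i = outputRoute σ i := by
  simp [outputRoute, h₄, ha₃, ha₄]

theorem Rep.congr {σ τ : State} {V : Finset (Fin I.n)} {S : List (Fin I.n)}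
    {R : Fin I.k → List (Fin I.n)} (h : Rep I V S R σ)
    (hv : ∀ x ∈ [0, 1, 2, 4, 6], τ.var x = σ.var x) (ha : τ.arr = σ.arr) : Rep I V S R τ where
  toHolds := h.toHolds.congr (fun x hx => by interval_cases x <;> exact hv _ (by simp))
    fun a _ => by rw [ha]
  mark := by rw [ha]; exact h.mark
  stack := by rw [ha, hv 6 (by simp)]; exact h.stack
  out i := by
    rw [outputRoute_congr (hv 4 (by simp)) (by rw [ha]) (by rw [ha])]
    exact h.out i

/-- Append the entry (variable `5`, variable `7`) to the output. -/
def emit : Cmd :=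
  .seq (.store 3 (.var 4) (.var 5)) (.seq (.store 4 (.var 4) (.var 7))
    (.assign 4 (.add (.var 4) (.lit 1))))

/-- The memory after `emit`. -/
def emitted (σ : State) : State :=
  ((σ.setArr 3 (σ.var 4) (σ.var 5)).setArr 4 (σ.var 4) (σ.var 7)).setVar 4 (σ.var 4 + 1)

theorem runs_emit {σ : State} {Q : State → Prop} (h : Q (emitted σ)) : Runs emit σ 10 Q :=
  .seq (s := 3) (t := 7) (.store (.seq (s := 3) (t := 4) (.store (.assign h))))

/-- The new entry is written at the old output length, beyond all positions read so far, so the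
earlier entries are undisturbed. -/
theorem outputRoute_emitted (σ : State) (i : ℕ) :
    outputRoute (emitted σ) i = outputRoute σ i ++ if σ.var 5 = i then [σ.var 7] else [] := by
  have h₁ : (List.range (σ.var 4)).filter (fun j => (emitted σ).arr 3 j = i) =
      (List.range (σ.var 4)).filter (fun j => σ.arr 3 j = i) := by
    refine List.filter_congr fun j hj => ?_
    have : j ≠ σ.var 4 := (List.mem_range.1 hj).ne
    simp [emitted, this]
  have h₂ : ((List.range (σ.var 4)).filter (fun j => σ.arr 3 j = i)).map ((emitted σ).arr 4) =
      ((List.range (σ.var 4)).filter (fun j => σ.arr 3 j = i)).map (σ.arr 4) := by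
    refine List.map_congr_left fun j hj => ?_
    have : j ≠ σ.var 4 := (List.mem_range.1 (List.mem_filter.1 hj).1).ne
    simp [emitted, this]
  have h₃ : (emitted σ).var 4 = σ.var 4 + 1 := by simp [emitted]
  unfold outputRoute
  rw [h₃, List.range_succ, List.filter_append, List.map_append, h₁, h₂]
  congr 1
  have h₅ : (emitted σ).arr 3 (σ.var 4) = σ.var 5 := by simp [emitted]
  have h₇ : (emitted σ).arr 4 (σ.var 4) = σ.var 7 := by simp [emitted]
  by_cases h : σ.var 5 = i
  · simp [h₅, h₇, h]
  · simp [h₅, h]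

theorem Rep.emitted {σ : State} {V : Finset (Fin I.n)} {S : List (Fin I.n)}
    {R : Fin I.k → List (Fin I.n)} (h : Rep I V S R σ) {a : Fin I.k} (ha : σ.var 5 = a)
    {x : Fin I.n} (hx : σ.var 7 = x) : Rep I V S (extend R a x) (emitted σ) where
  toHolds := h.toHolds.congr
    (fun y hy => by simp [CMAPF.emitted, show y ≠ 4 by omega])
    (fun b hb => by
      have : b ≠ 3 ∧ b ≠ 4 := by constructor <;> rintro rfl <;> simp at hb
      simp [CMAPF.emitted, this])
  mark := by simpa [CMAPF.emitted] using h.mark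
  stack := by simpa [CMAPF.emitted] using h.stack
  out i := by
    rw [outputRoute_emitted, h.out i, ha, hx]
    by_cases hi : i = a
    · simp [extend, hi]
    · have : a.val ≠ i.val := fun e => hi (Fin.ext e.symm)
      simp [extend, hi, this]

/-! ### One move of the search. -/

/-- Set variable `8` to an unmarked neighbour of the node in variable `7`, or to the number of
nodes if there is none. -/
def findNext : Cmd :=
  .seq (.assign 8 (.var 0)) (.for 9 0
    (.ite (.get 0 (.add (.get 7 (.var 7)) (.var 9)))
      (.ite (.get 5 (.var 9)) .skip (.assign 8 (.var 9))) .skip))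

/-- The scan has no early exit; the last unmarked neighbour found wins. The final value `j` of the
counter is irrelevant to callers. -/
theorem runs_findNext {σ : State} {V : Finset (Fin I.n)} {S : List (Fin I.n)}
    {R : Fin I.k → List (Fin I.n)} {Q : State → Prop} (h : Rep I V S R σ)
    {x : Fin I.n} (hx : σ.var 7 = x)
    (hnone : ∀ j, (∀ w, I.G.Adj x w → w ∈ V) → Q ((σ.setVar 8 I.n).setVar 9 j))
    (hsome : ∀ j, ∀ y : Fin I.n, I.G.Adj x y → y ∉ V → Q ((σ.setVar 8 y).setVar 9 j)) :
    Runs findNext σ (2 + (2 + (I.n + 1) * 20)) Q := by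
  refine .seq (.assign ?_)
  refine (Runs.for (B := 12) (N := I.n) (fun j τ => ∃ b, τ = (σ.setVar 8 b).setVar 9 j ∧
    ((b = I.n ∧ ∀ w : Fin I.n, w.val < j → I.G.Adj x w → w ∈ V) ∨
      ∃ y : Fin I.n, b = y ∧ I.G.Adj x y ∧ y ∉ V)) ?_ ?_ ?_ ?_).mono le_rfl fun _ => id
  · rintro j τ ⟨b, rfl, -⟩
    simp [h.n]
  · rintro j τ hj ⟨b, rfl, hb⟩
    have hadj := h.entry x ⟨j, hj⟩
    have hmark := h.mark ⟨j, hj⟩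
    -- The invariant gives the state as `σ` with variables 8 and 9 overwritten, in this order; the
    -- updates made by the body are brought back to that form.
    have hset : ∀ b', ((σ.setVar 8 b').setVar 9 j).setVar 9 (j + 1) =
        (σ.setVar 8 b').setVar 9 (j + 1) := fun b' => by simp [State.setVar]
    have hset' : (((σ.setVar 8 b).setVar 9 j).setVar 8 j).setVar 9 (j + 1) =
        (σ.setVar 8 j).setVar 9 (j + 1) := by
      simp only [State.setVar]
      congr 1
      funext z
      simp only [Function.update_apply]
      split_ifs <;> rfl
    -- Common to the two branches that leave variable 8 alone: `j` is not a neighbour, or is already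
    -- marked.
    have hkeep : (I.G.Adj x ⟨j, hj⟩ → ⟨j, hj⟩ ∈ V) →
        ((σ.setVar 8 b).setVar 9 j).var 9 = j ∧
        ∃ b', ((σ.setVar 8 b).setVar 9 j).setVar 9 (j + 1) =
          (σ.setVar 8 b').setVar 9 (j + 1) ∧
        ((b' = I.n ∧ ∀ w : Fin I.n, w.val < j + 1 → I.G.Adj x w → w ∈ V) ∨
          ∃ y : Fin I.n, b' = y ∧ I.G.Adj x y ∧ y ∉ V) := by
      refine fun hj' => ⟨by simp, b, hset b, hb.imp_left fun ⟨e, hw⟩ => ⟨e, fun w hwj => ?_⟩⟩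
      rcases Nat.lt_succ_iff_lt_or_eq.1 hwj with hlt | heq
      · exact hw w hlt
      · obtain rfl : w = ⟨j, hj⟩ := Fin.ext heq
        exact hj'
    refine (Runs.ite (s := 6) (t := 1) (fun he => ?_) fun he => ?_).mono (by simp [Expr.cost])
      fun _ => id
    · have hAdj : I.G.Adj x ⟨j, hj⟩ := by
        by_contra hn
        refine he ?_
        simpa [Expr.eval, hx, entry_eq_zero, hn] using hadj.trans (entry_eq_zero.2 hn)
      refine (Runs.ite (s := 1) (t := 2) (fun he' => .skip (hkeep fun _ => ?_))
        fun he' => .assign ?_).mono (by simp [Expr.cost]) fun _ => id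
      · by_contra hn
        exact he' (by simpa [Expr.eval] using hmark.2 hn)
      · refine ⟨by simp, j, by simpa [Expr.eval] using hset', .inr ⟨⟨j, hj⟩, rfl, hAdj, ?_⟩⟩
        exact hmark.1 (by simpa [Expr.eval] using he')
    · refine .skip (hkeep fun hAdj => ?_)
      have : I.entry x ⟨j, hj⟩ = 0 := by
        rw [← hadj]
        simpa [Expr.eval, hx] using he
      exact absurd hAdj (entry_eq_zero.1 this)
  · rintro τ ⟨b, rfl, ⟨rfl, hw⟩ | ⟨y, rfl, hxy, hy⟩⟩
    · exact hnone _ fun w => hw w w.isLt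
    · exact hsome _ y hxy hy
  · refine ⟨I.n, by simp [Expr.eval, h.n], .inl ⟨rfl, by simp⟩⟩

/-- Covers only the mark and the stack; the route entry is added afterwards by `Rep.emitted`. -/
theorem Rep.push {σ : State} {V : Finset (Fin I.n)} {S : List (Fin I.n)}
    {R : Fin I.k → List (Fin I.n)} (h : Rep I V S R σ) (y : Fin I.n) :
    Rep I (insert y V) (y :: S) R
      (((σ.setArr 5 y 1).setVar 6 (σ.var 6 + 1)).setArr 6 (σ.var 6 + 1) y) where
  toHolds := h.toHolds.congr
    (fun z hz => by simp [show z ≠ 6 by omega])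
    (fun b hb => by
      have : b ≠ 5 ∧ b ≠ 6 := by constructor <;> rintro rfl <;> simp at hb
      simp [this])
  mark v := by
    by_cases hv : v = y
    · simp [hv]
    · have : v.val ≠ y.val := fun e => hv (Fin.ext e)
      simp [hv, this, h.mark v]
  stack := by simpa using h.stack.push y
  out i := by
    rw [← h.out i]
    exact outputRoute_congr (by simp) (by simp) (by simp) i

theorem Rep.pop {σ : State} {V : Finset (Fin I.n)} {x : Fin I.n} {S : List (Fin I.n)}
    {R : Fin I.k → List (Fin I.n)} (h : Rep I V (x :: S) R σ) :
    Rep I V S R (σ.setVar 6 (σ.var 6 - 1)) where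
  toHolds := h.toHolds.congr (fun z hz => by simp [show z ≠ 6 by omega]) (fun b hb => by simp)
  mark := h.mark
  stack := by
    have := h.stack
    simp only [State.arr_setVar, State.var_setVar, if_true]
    generalize σ.var 6 = d at *
    cases d with
    | zero => simp [StackRep] at this
    | succ d => exact this.2
  out i := by
    rw [← h.out i]
    exact outputRoute_congr (by simp) (by simp) (by simp) i

theorem Rep.top {σ : State} {V : Finset (Fin I.n)} {x : Fin I.n} {S : List (Fin I.n)}
    {R : Fin I.k → List (Fin I.n)} (h : Rep I V (x :: S) R σ) : σ.arr 6 (σ.var 6) = x := by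
  have := h.stack
  generalize σ.var 6 = d at *
  cases d with
  | zero => simp [StackRep] at this
  | succ d => exact this.1

/-- Move on from the node on top of the stack to an unmarked neighbour, or else go back. -/
def advance : Cmd :=
  .seq (.assign 7 (.get 6 (.var 6))) (.seq findNext (.ite (.sub (.var 0) (.var 8))
    (.seq (.store 5 (.var 8) (.lit 1)) (.seq (.assign 6 (.add (.var 6) (.lit 1)))
      (.seq (.store 6 (.var 6) (.var 8)) (.seq (.assign 7 (.var 8)) emit))))
    (.seq (.assign 6 (.sub (.var 6) (.lit 1))) (.ite (.var 6)
      (.seq (.assign 7 (.get 6 (.var 6))) emit) .skip))))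

/-- Agent `a` is on its tour, and the nodes that it has yet to enter and leave again number `N`;
the length of the output plus `N` is at most `L`. -/
def Touring (I : CMAPF) (a : Fin I.k) (L N : ℕ) (σ : State) : Prop :=
  ∃ V S R, Rep I V S R σ ∧ I.Tour (a + 1) V S R ∧ σ.var 5 = a ∧
    N = 2 * (I.n - V.card) + S.length ∧ σ.var 4 + N ≤ L

theorem runs_advance {a : Fin I.k} {L N : ℕ} {σ : State} (h : Touring I a L N σ)
    (hσ : σ.var 6 ≠ 0) :
    ∃ M < N, Runs advance σ (3 + (2 + (2 + (I.n + 1) * 20) + 26)) (Touring I a L M) := by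
  obtain ⟨V, S, R, hrep, htour, ha, rfl, hL⟩ := h
  cases S with
  | nil => exact absurd hrep.stack.length_eq hσ
  | cons x S =>
  -- The same new count serves both outcomes: a push trades an unmarked node, worth 2, for a stack
  -- entry, worth 1, and a pop drops a stack entry.
  refine ⟨2 * (I.n - V.card) + S.length, by simp, .seq (.assign ?_)⟩
  simp only [List.length_cons] at hL
  have hrep' : Rep I V (x :: S) R (σ.setVar 7 (σ.arr 6 (σ.var 6))) :=
    hrep.congr (fun z hz => by
      have : z ≠ 7 := by rintro rfl; simp at hz
      simp [this]) rfl
  refine .seq (runs_findNext hrep' (x := x) (by simpa [Expr.eval] using hrep.top) (fun j hx => ?_)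
    fun j y hxy hy => ?_)
  -- No neighbour was found: variable 8 equals `n`, the test `n - n` is zero, and the agent goes
  -- back.
  · refine (Runs.ite (s := 22) (t := 19) (fun he => ?_) fun he => ?_).mono (by simp [Expr.cost])
      fun _ => id
    · simp [Expr.eval, hrep.n] at he
    · refine .seq (s := 4) (t := 15) (.assign ?_)
      have hrep'' : Rep I V (x :: S) R
          (((σ.setVar 7 (σ.arr 6 (σ.var 6))).setVar 8 I.n).setVar 9 j) :=
        hrep'.congr (fun z hz => by
          have : z ≠ 8 ∧ z ≠ 9 := by constructor <;> rintro rfl <;> simp at hz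
          simp [this]) rfl
      have hpop := hrep''.pop
      cases S with
      | nil =>
        refine (Runs.ite (s := 13) (t := 1) (fun he => ?_) fun he => .skip ?_).mono
          (by simp [Expr.cost]) fun _ => id
        · exact absurd hpop.stack.length_eq he
        · refine ⟨V, [], R, hpop, htour.pop_last hx, by simpa using ha, by simp, ?_⟩
          simp at hL ⊢
          omega
      | cons z S =>
        refine (Runs.ite (s := 13) (t := 1) (fun he => ?_) fun he => ?_).mono
          (by simp [Expr.cost]) fun _ => id
        · refine .seq (s := 3) (t := 10) (.assign (runs_emit ?_))
          refine ⟨V, z :: S, extend R a z, ?_, htour.pop a rfl hx, ?_, rfl, ?_⟩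
          · refine Rep.emitted ?_ ?_ ?_
            · refine hpop.congr (fun z hz => ?_) rfl
              have : z ≠ 7 := by rintro rfl; simp at hz
              simp [this, Expr.eval]
            · simpa using ha
            · simpa [Expr.eval] using hpop.top
          · simpa [emitted] using ha
          · simp [emitted] at hL ⊢
            omega
        · exact absurd (hpop.stack.length_eq.symm.trans he) (by simp)
  · refine (Runs.ite (s := 22) (t := 19) (fun he => ?_) fun he => ?_).mono (by simp [Expr.cost])
      fun _ => id
    · have hrep'' : Rep I V (x :: S) R
          (((σ.setVar 7 (σ.arr 6 (σ.var 6))).setVar 8 y).setVar 9 j) :=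
        hrep'.congr (fun z hz => by
          have : z ≠ 8 ∧ z ≠ 9 := by constructor <;> rintro rfl <;> simp at hz
          simp [this]) rfl
      have hpush := hrep''.push y
      refine .seq (s := 3) (t := 19) (.store (.seq (s := 4) (t := 15) (.assign
        (.seq (s := 3) (t := 12) (.store (.seq (s := 2) (t := 10) (.assign
        (runs_emit ?_))))))))
      have hcard := Finset.card_insert_of_notMem hy
      have hle := Finset.card_le_univ (insert y V)
      rw [Fintype.card_fin] at hle
      refine ⟨insert y V, y :: x :: S, extend R a y,
        Rep.emitted (hpush.congr (fun z hz => ?_) ?_) ?_ ?_, htour.push a rfl hxy hy, ?_, ?_, ?_⟩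
      · have : z ≠ 7 := by rintro rfl; simp at hz
        simp [this, Expr.eval]
      · simp [Expr.eval]
      · simpa using ha
      · simp [Expr.eval]
      · simpa [emitted] using ha
      · simp only [List.length_cons]
        omega
      · simp [emitted] at hL ⊢
        omega
    · have : I.n ≤ y := by simpa [Expr.eval, hrep.n, Nat.sub_eq_zero_iff_le] using he
      omega

/-! ### The tour of one agent. -/

/-- Let the agent in variable `5` set out and explore the graph. -/
def tour : Cmd :=
  .seq (.assign 7 (.get 1 (.var 5))) (.seq (.assign 6 (.lit 1))
    (.seq (.store 6 (.var 6) (.var 7)) (.seq emit (.while (.var 6) advance))))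

/-- The first `c` agents have completed their tours. -/
def Toured (I : CMAPF) (c : ℕ) (σ : State) : Prop :=
  ∃ V R, Rep I V [] R σ ∧ I.Tour c V [] R ∧ σ.var 5 = c ∧
    σ.var 4 + 2 * (I.n - V.card) ≤ 2 * I.n + 2 * c

theorem runs_tour {c : ℕ} (hc : c < I.k) {σ : State} (h : Toured I c σ) :
    Runs tour σ (18 + (2 * I.n + 2) * (2 + (33 + (I.n + 1) * 20)))
      fun τ => τ.var 5 = c ∧ Toured I (c + 1) (τ.setVar 5 (c + 1)) := by
  obtain ⟨V, R, hrep, htour, hσ, hL⟩ := h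
  -- The bound is split along the program: four initial commands of costs 3, 2, 3 and 10, then the
  -- loop with variant at most `2n + 1`.
  rw [show 18 + (2 * I.n + 2) * (2 + (33 + (I.n + 1) * 20)) = 3 + (2 + (3 + (10 +
    (2 * I.n + 1 + 1) * ((Expr.var 6).cost + 1 + (3 + (2 + (2 + (I.n + 1) * 20) + 26)))))) by
      simp only [Expr.cost]; ring]
  refine .seq (.assign (.seq (.assign (.seq (s := 3) (.store (.seq (runs_emit ?_)))))))
  refine (Runs.while (N := 2 * (I.n - V.card) + 1)
    -- Setting out costs 2 of the output budget: one entry for the start, and one stack entry.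
    (Touring I ⟨c, hc⟩ (2 * I.n + 2 * (c + 1))) (fun N σ => runs_advance)
    ?_ ?_).mono (Nat.mul_le_mul_right _ (by omega)) fun _ => id
  · rintro N τ ⟨V, S, R, hrep, htour, hτ, rfl, hL⟩ he
    have hS := hrep.stack.length_eq
    obtain rfl : S = [] := List.eq_nil_of_length_eq_zero (hS.symm.trans he)
    refine ⟨hτ, V, R, hrep.congr (fun z hz => ?_) rfl, htour, by simp, by simpa using hL⟩
    have : z ≠ 5 := by rintro rfl; simp at hz
    simp [this]
  · have hstart : σ.arr 1 c = I.start ⟨c, hc⟩ := hrep.start ⟨c, hc⟩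
    refine ⟨V, [I.start ⟨c, hc⟩], extend R ⟨c, hc⟩ (I.start ⟨c, hc⟩),
      Rep.emitted ⟨hrep.toHolds.congr ?_ ?_, ?_, ?_, ?_⟩ ?_ ?_, htour.setOut _ rfl, ?_, ?_, ?_⟩
    · intro z hz
      simp [show z ≠ 6 by omega, show z ≠ 7 by omega]
    · intro b hb
      have : b ≠ 6 := by rintro rfl; simp at hb
      simp [this]
    · simpa using hrep.mark
    · simp [Expr.eval, StackRep, hσ, hstart]
    · intro i
      rw [← hrep.out i]
      exact outputRoute_congr (by simp) (by simp) (by simp) i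
    · simpa using hσ
    · simp [Expr.eval, hσ, hstart]
    · simpa [emitted] using hσ
    · simp
    · simp [emitted]
      omega

/-! ### The phases of the whole program. -/

/-- Compute the row offsets of the adjacency matrix. -/
def offsets : Cmd :=
  .for 9 0 (.seq (.store 7 (.var 9) (.var 10)) (.assign 10 (.add (.var 10) (.var 0))))

/-- Mark the starting nodes. -/
def markStarts : Cmd :=
  .for 5 1 (.store 5 (.get 1 (.var 5)) (.lit 1))

/-- Set variable `3` to `1` if all goals are marked, and to `0` otherwise. -/
def checkGoals : Cmd :=
  .seq (.assign 3 (.lit 1)) (.for 9 2 (.ite (.get 5 (.get 2 (.var 9))) .skip (.assign 3 (.lit 0))))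

/-- Decide whether the instance is solvable, and find a solution in which the agents explore
disjoint parts of the graph. -/
def solver : Cmd :=
  .seq offsets (.seq markStarts (.seq (.for 5 1 tour) checkGoals))

theorem runs_offsets {Q : State → Prop}
    (h : ∀ σ, Holds I σ → σ.var 4 = 0 → σ.var 6 = 0 → (∀ v, σ.arr 5 v = 0) → Q σ) :
    Runs offsets I.input (2 + (I.n + 1) * 15) Q := by
  refine (Runs.for (B := 7) (N := I.n) (fun j σ => (∀ x < 9, σ.var x = I.input.var x) ∧
    (∀ a ≠ 7, σ.arr a = I.input.arr a) ∧ σ.var 9 = j ∧ σ.var 10 = j * I.n ∧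
    ∀ u < j, σ.arr 7 u = u * I.n) ?_ ?_ ?_ ?_).mono le_rfl fun _ => id
  · rintro j σ ⟨hv, -, h9, -⟩
    exact ⟨h9, by simp [hv 0 (by simp), input]⟩
  · rintro j σ hj ⟨hv, ha, h9, h10, h7⟩
    have h0 : σ.var 0 = I.n := by simp [hv 0 (by simp), input]
    refine .seq (s := 3) (t := 4) (.store (.assign ⟨by simp [h9], fun x hx => ?_, fun a ha7 => ?_,
      by simp, by simp [Expr.eval, h0, h10]; ring, fun u hu => ?_⟩))
    · simpa [show x ≠ 9 by omega, show x ≠ 10 by omega] using hv x hx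
    · simpa [ha7] using ha a ha7
    · by_cases huj : u = j
      · simp [Expr.eval, h9, h10, huj]
      · simpa [Expr.eval, h9, huj] using h7 u (by omega)
  · rintro σ ⟨hv, ha, -, -, h7⟩
    refine h σ ⟨?_, ?_, ?_, fun u v => ?_, fun i => ?_, fun j => ?_⟩ ?_ ?_ fun v => ?_
    · simp [hv 0 (by simp), input]
    · simp [hv 1 (by simp), input]
    · simp [hv 2 (by simp), input]
    -- `input` decodes positions by the inverse of `finProdFinEquiv`, so `u * n + v` is recognised
    -- as the code of `(u, v)`; the row offset `u * n` was obtained by repeated addition.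
    · have hp : finProdFinEquiv (u, v) = (⟨u * I.n + v, by
          have := (finProdFinEquiv (u, v)).isLt
          simpa [finProdFinEquiv, mul_comm, add_comm] using this⟩ : Fin (I.n * I.n)) := by
        ext
        simp [finProdFinEquiv, mul_comm, add_comm]
      have hlt : u * I.n + v < I.n * I.n := (Fin.mk _ _).isLt.trans_eq' (congrArg Fin.val hp)
      rw [h7 u u.isLt, ha 0 (by simp)]
      simp only [input, if_true, hlt, dif_pos]
      rw [← hp, Equiv.symm_apply_apply]
    · simp [ha 1 (by simp), input]
    · simp [ha 2 (by simp), input]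
    · simp [hv 4 (by simp), input]
    · simp [hv 6 (by simp), input]
    · simp [ha 5 (by simp), input]
  · refine ⟨fun x hx => by simp [show x ≠ 9 by omega], by simp, by simp, by simp [input], by simp⟩

theorem runs_markStarts {σ : State} (h : Holds I σ) (h4 : σ.var 4 = 0) (h6 : σ.var 6 = 0)
    (h5 : ∀ v, σ.arr 5 v = 0) :
    Runs markStarts σ (2 + (I.k + 1) * 12) fun τ => Toured I 0 (τ.setVar 5 0) := by
  refine (Runs.for (B := 4) (N := I.k) (fun j τ => Holds I τ ∧ τ.var 4 = 0 ∧ τ.var 6 = 0 ∧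
    τ.var 5 = j ∧ ∀ v : Fin I.n, τ.arr 5 v = 0 ↔ ∀ i : Fin I.k, i.val < j → v ≠ I.start i)
    ?_ ?_ ?_ ?_).mono le_rfl fun _ => id
  · rintro j τ ⟨h, -, -, hj, -⟩
    exact ⟨hj, h.k⟩
  · rintro j τ hj ⟨h, h4, h6, h5, hv⟩
    have hstart : τ.arr 1 j = I.start ⟨j, hj⟩ := h.start ⟨j, hj⟩
    refine .store ⟨by simpa using h5, h.congr ?_ ?_, by simpa using h4, by simpa using h6,
      by simp, fun v => ?_⟩
    · intro x hx
      simp [show x ≠ 5 by omega]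
    · intro a ha
      have : a ≠ 5 := by rintro rfl; simp at ha
      simp [this]
    · by_cases hvj : v = I.start ⟨j, hj⟩
      · simp only [Expr.eval, h5, hstart, State.arr_setVar, State.arr_setArr, if_true, hvj,
          Function.update_self, one_ne_zero, false_iff, not_forall]
        exact ⟨⟨j, hj⟩, by simp, by simp⟩
      · have hne : v.val ≠ I.start ⟨j, hj⟩ := fun e => hvj (Fin.ext e)
        simp only [Expr.eval, h5, hstart, State.arr_setVar, State.arr_setArr, if_true, ne_eq, hne,
          not_false_eq_true, Function.update_of_ne, hv v]
        refine ⟨fun hi i hij => ?_, fun hi i hij => hi i (by omega)⟩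
        rcases Nat.lt_succ_iff_lt_or_eq.1 hij with hlt | heq
        · exact hi i hlt
        · obtain rfl : i = ⟨j, hj⟩ := Fin.ext heq
          exact hvj
  · rintro τ ⟨h, h4, h6, -, hv⟩
    refine ⟨_, _, ⟨h.congr ?_ (by simp), fun v => ?_, ?_, fun i => ?_⟩, Tour.init, by simp, ?_⟩
    · intro x hx
      simp [show x ≠ 5 by omega]
    · simp only [State.arr_setVar, hv v, Finset.mem_image, Finset.mem_univ, true_and, not_exists]
      exact ⟨fun hi i e => hi i i.isLt e.symm, fun hi i _ e => hi i e.symm⟩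
    · simp [h6, StackRep]
    · simp [outputRoute, h4]
    · simp [h4]
  · refine ⟨h.congr ?_ (by simp), by simpa using h4, by simpa using h6, by simp, by simp [h5]⟩
    intro x hx
    simp [show x ≠ 5 by omega]

theorem runs_checkGoals {σ : State} (h : Toured I I.k σ) :
    Runs checkGoals σ (2 + (2 + (I.m + 1) * 15))
      fun τ => τ.var 4 ≤ 2 * I.n + 2 * I.k ∧ I.CorrectAnswer τ := by
  classical
  obtain ⟨V, R, hrep, htour, -, hL⟩ := h
  refine .seq (.assign ((Runs.for (B := 7) (N := I.m) (fun j τ => Rep I V [] R τ ∧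
    τ.var 4 = σ.var 4 ∧ τ.var 9 = j ∧
    τ.var 3 = if ∀ g : Fin I.m, g.val < j → I.goal g ∈ V then 1 else 0)
    ?_ ?_ ?_ ?_).mono le_rfl fun _ => id))
  · rintro j τ ⟨h, -, hj, -⟩
    exact ⟨hj, h.m⟩
  · rintro j τ hj ⟨h, h4, h9, h3⟩
    have hgoal : τ.arr 2 j = I.goal ⟨j, hj⟩ := h.goal ⟨j, hj⟩
    have hmark := h.mark (I.goal ⟨j, hj⟩)
    refine (Runs.ite (s := 1) (t := 2) (fun he => .skip ?_) fun he => .assign ?_).mono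
      (by simp [Expr.cost]) fun _ => id
    · simp only [Expr.eval, h9, hgoal, ne_eq, hmark, not_not] at he
      refine ⟨h9, h.congr ?_ rfl, by simpa using h4, by simp, ?_⟩
      · intro z hz
        have : z ≠ 9 := by rintro rfl; simp at hz
        simp [this]
      · simp only [State.var_setVar, Nat.reduceEqDiff, if_false, h3]
        refine if_congr ⟨fun hi i hij => ?_, fun hi i hij => hi i (by omega)⟩ rfl rfl
        rcases Nat.lt_succ_iff_lt_or_eq.1 hij with hlt | heq
        · exact hi i hlt
        · obtain rfl : i = ⟨j, hj⟩ := Fin.ext heq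
          exact he
    · simp only [Expr.eval, h9, hgoal, hmark] at he
      refine ⟨by simpa using h9, h.congr ?_ rfl, by simpa using h4, by simp, ?_⟩
      · intro z hz
        have : z ≠ 9 ∧ z ≠ 3 := by constructor <;> rintro rfl <;> simp at hz
        simp [this]
      -- One unmarked goal settles the answer: variable 3 becomes 0 and no later round restores it.
      · rw [if_neg fun hi => he (hi ⟨j, hj⟩ (by simp))]
        simp [Expr.eval]
  · rintro τ ⟨h, h4, -, h3⟩
    have hsol : I.Solvable ↔ ∀ g : Fin I.m, g.val < I.m → I.goal g ∈ V := by
      simp [htour.solvable_iff]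
    rw [← if_congr hsol rfl rfl] at h3
    refine ⟨by omega, fun hs => ⟨by simpa [hs] using h3, R, ?_, h.out⟩, fun hs => by
      simpa [hs] using h3⟩
    exact htour.isSolution (htour.solvable_iff.1 hs)
  · refine ⟨hrep.congr ?_ rfl, by simp, by simp, by simp [Expr.eval]⟩
    intro z hz
    have : z ≠ 9 ∧ z ≠ 3 := by constructor <;> rintro rfl <;> simp at hz
    simp [this]

theorem runs_solver : Runs solver I.input
    ((2 + (I.n + 1) * 15) + ((2 + (I.k + 1) * 12) + ((2 + (I.k + 1) * (8 +
      (18 + (2 * I.n + 2) * (2 + (33 + (I.n + 1) * 20))))) + (2 + (2 + (I.m + 1) * 15)))))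
    fun τ => τ.var 4 ≤ 2 * I.n + 2 * I.k ∧ I.CorrectAnswer τ := by
  refine .seq (runs_offsets fun σ h h4 h6 h5 => .seq ((runs_markStarts h h4 h6 h5).mono le_rfl
    fun τ hτ => .seq ?_))
  refine Runs.for (Toured I) ?_ (fun _ _ hj => runs_tour hj) (fun _ => runs_checkGoals) hτ
  rintro j σ ⟨_, _, h, -, h5, -⟩
  exact ⟨h5, h.k⟩

end CMAPF

theorem mainTheorem2 :
    ∃ prog : RAM.Cmd, ∀ q : Polynomial ℕ, ∃ p : MvPolynomial (Fin 3) ℕ,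
      ∀ I : CMAPF, I.k ≤ I.m → (∀ u v, I.G.Adj u v → I.w s(u, v) ≤ q.eval I.n) →
        ∃ (t : ℕ) (σ : RAM.State), RAM.Exec prog I.input t σ ∧
          t ≤ MvPolynomial.eval ![I.n, I.k, I.m] p ∧
          σ.var 4 ≤ MvPolynomial.eval ![I.n, I.k, I.m] p ∧ I.CorrectAnswer σ := by
  -- The witness is the step bound of `runs_solver` read as a polynomial; it also dominates the
  -- output bound `2n + 2k`.
  refine ⟨CMAPF.solver, fun _ => ⟨(2 + (.X 0 + 1) * 15) + ((2 + (.X 1 + 1) * 12) +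
    ((2 + (.X 1 + 1) * (8 + (18 + (2 * .X 0 + 2) * (2 + (33 + (.X 0 + 1) * 20))))) +
      (2 + (2 + (.X 2 + 1) * 15)))), fun I _ _ => ?_⟩⟩
  obtain ⟨t, σ, h, ht, hσ, hI⟩ := CMAPF.runs_solver (I := I)
  refine ⟨t, σ, h, by simpa using ht, hσ.trans ?_, hI⟩
  simp
  nlinarith [Nat.zero_le (I.k * I.n), Nat.zero_le (I.k * (I.n * I.n))]
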